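/- Let $(r_n)_{n\ge1},(a_n)_{n\ge1},(d_n)_{n\ge1}$ be real sequences with $r_n>0$ and $d_n\ge 0$ for all $n\ge 1$, $a_1=0$, and $a_n>0$ for $n\ge 2$. Put $\theta_n=r_n+a_n+d_n$ and $c_n=a_n+d_n+\frac{r_n}{n}$. Let $X$ be the space of real sequences $f=(f_n)_{n\ge1}$ with $\|f\|=\sum_{n\ge1} n|f_n|<\infty$. Define operators in $X$ by $$[A_0f]_n=-\theta_nf_n,\quad D(A_0)=\{f\in X:(\theta_nf_n)_n\in X\},\qquad [A_1f]_n=r_{n+1}f_{n+1},\quad D(A_1)=\{f\in X:(r_nf_n)_n\in X\}.$$ Then $D(A_0)\subseteq D(A_1)$, the operator $(A_0+A_1,D(A_0))$ is closable, and its closure $K=\overline{A_0+A_1}$ generates a substochastic $C_0$-semigroup on $X$, i.e. a strongly continuous semigroup $(S(t))_{t\ge0}$ of bounded linear operators with $\|S(t)\|\le1$ and $S(t)f\ge0$ (coordinatewise) whenever $f\ge0$. Moreover, for every $f\in D(K)$ the series $c(f):=\sum_{n\ge1}n\,c_n f_n$ converges absolutely and $$\sum_{n=1}^\infty n\,[Kf]_n=-c(f).$$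 -/

import Mathlib

open Filter Topology
open scoped NNReal

noncomputable section

/-- The real sequences `(f_n)_{n ≥ 1}` with `∑ n |f_n| < ∞`, as a linear subspace of all
sequences. Cluster sizes are the positive integers `ℕ+`. -/
def massSubmodule : Submodule ℝ (ℕ+ → ℝ) where
  carrier := {f | Summable fun n : ℕ+ => (n : ℝ) * |f n|}
  zero_mem' := by simp [summable_zero]
  add_mem' {f g} hf hg := by
    refine Summable.of_nonneg_of_le (fun n => by positivity) (fun n => ?_) (hf.add hg)
    rw [← mul_add]
    exact mul_le_mul_of_nonneg_left (abs_add_le (f n) (g n)) (by positivity)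
  smul_mem' c f hf := by
    have h : Summable fun n : ℕ+ => (n : ℝ) * |f n| := hf
    refine (h.mul_left |c|).congr (fun n => ?_)
    simp only [Pi.smul_apply, smul_eq_mul, abs_mul]
    ring

/-- The space `X` of sequences of finite total mass, with norm `‖f‖ = ∑ n |f_n|`
(a separate type, so that it does not carry the topology of coordinatewise convergence). -/
def MassSpace : Type := massSubmodule

namespace MassSpace

instance : AddCommGroup MassSpace := inferInstanceAs (AddCommGroup massSubmodule)

instance : Module ℝ MassSpace := inferInstanceAs (Module ℝ massSubmodule)

instance : CoeFun MassSpace (fun _ => ℕ+ → ℝ) := ⟨fun f => f.1⟩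

/-- The element of `X` given by a sequence of finite mass. -/
def mk (f : ℕ+ → ℝ) (hf : Summable fun n : ℕ+ => (n : ℝ) * |f n|) : MassSpace := ⟨f, hf⟩

@[simp] theorem mk_apply (f : ℕ+ → ℝ) (hf : Summable fun n : ℕ+ => (n : ℝ) * |f n|) (n : ℕ+) :
    mk f hf n = f n := rfl

@[simp] theorem zero_apply (n : ℕ+) : (0 : MassSpace) n = 0 := rfl

@[simp] theorem add_apply (f g : MassSpace) (n : ℕ+) : (f + g) n = f n + g n := rfl

@[simp] theorem neg_apply (f : MassSpace) (n : ℕ+) : (-f) n = -f n := rfl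

@[simp] theorem smul_apply (c : ℝ) (f : MassSpace) (n : ℕ+) : (c • f) n = c * f n := rfl

@[ext] theorem ext {f g : MassSpace} (h : ∀ n, f n = g n) : f = g := Subtype.ext (funext h)

theorem summable (f : MassSpace) : Summable fun n : ℕ+ => (n : ℝ) * |f n| := f.2

instance : NormedAddCommGroup MassSpace :=
  AddGroupNorm.toNormedAddCommGroup
    { toFun := fun f => ∑' n : ℕ+, (n : ℝ) * |f n|
      map_zero' := by simp
      add_le' := fun f g => by
        rw [← f.summable.tsum_add g.summable]
        refine (f + g).summable.tsum_le_tsum (fun n => ?_) (f.summable.add g.summable)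
        rw [← mul_add]
        exact mul_le_mul_of_nonneg_left (abs_add_le (f n) (g n)) (by positivity)
      neg' := fun f => by simp
      eq_zero_of_map_eq_zero' := fun f hf => by
        ext n
        have h := (hasSum_zero_iff_of_nonneg
          (f := fun n : ℕ+ => (n : ℝ) * |f n|) (fun n => by positivity)).1
          (hf ▸ f.summable.hasSum)
        simpa using congrFun h n }

theorem norm_def (f : MassSpace) : ‖f‖ = ∑' n : ℕ+, (n : ℝ) * |f n| := rfl

instance : NormedSpace ℝ MassSpace where
  norm_smul_le c f := by
    rw [norm_def, norm_def, Real.norm_eq_abs, ← tsum_mul_left]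
    refine le_of_eq (tsum_congr fun n => ?_)
    rw [smul_apply, abs_mul]
    ring

/-- Membership in the positive cone `X_+`. -/
def IsNonneg (f : MassSpace) : Prop := ∀ n, 0 ≤ f n

end MassSpace

/-- The domain `{f ∈ X : w f ∈ X}` of multiplication by the sequence `w`. -/
def mulDomain (w : ℕ+ → ℝ) : Submodule ℝ MassSpace where
  carrier := {f | Summable fun n : ℕ+ => (n : ℝ) * |w n * f n|}
  zero_mem' := by simp [summable_zero]
  add_mem' {f g} hf hg := by
    refine Summable.of_nonneg_of_le (fun n => by positivity) (fun n => ?_) (hf.add hg)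
    rw [← mul_add, MassSpace.add_apply, mul_add]
    exact mul_le_mul_of_nonneg_left (abs_add_le (w n * f n) (w n * g n)) (by positivity)
  smul_mem' c f hf := by
    have h : Summable fun n : ℕ+ => (n : ℝ) * |w n * f n| := hf
    refine (h.mul_left |c|).congr (fun n => ?_)
    rw [MassSpace.smul_apply, mul_left_comm (w n), abs_mul c]
    ring

/-- The total loss rates `θ_i = r_i + a_i + d_i`. -/
def lossRate (r a d : ℕ+ → ℝ) (i : ℕ+) : ℝ := r i + a i + d i

/-- The diagonal operator `[A₀ f]_i = -θ_i f_i` with domain `{f ∈ X : θ f ∈ X}`. -/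
def lossOp (r a d : ℕ+ → ℝ) : MassSpace →ₗ.[ℝ] MassSpace where
  domain := mulDomain (lossRate r a d)
  toFun :=
    { toFun := fun f => MassSpace.mk (fun i => -(lossRate r a d i) * (f : MassSpace) i) (by
        have h : Summable fun n : ℕ+ => (n : ℝ) * |lossRate r a d n * (f : MassSpace) n| := f.2
        simpa only [neg_mul, abs_neg] using h)
      map_add' := fun f g => by ext i; simp; ring
      map_smul' := fun c f => by ext i; simp; ring }

theorem summable_shift {g : ℕ+ → ℝ} (hg : Summable fun n : ℕ+ => (n : ℝ) * |g n|) :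
    Summable fun n : ℕ+ => (n : ℝ) * |g (n + 1)| := by
  have hinj : Function.Injective fun n : ℕ+ => n + 1 := fun m n h => add_right_cancel h
  refine Summable.of_nonneg_of_le (fun n => by positivity) (fun n => ?_) (hg.comp_injective hinj)
  refine mul_le_mul_of_nonneg_right ?_ (abs_nonneg _)
  push_cast
  linarith

/-- The decay shift `[A₁ f]_i = r_{i+1} f_{i+1}` with domain `{f ∈ X : r f ∈ X}`. -/
def shiftOp (r : ℕ+ → ℝ) : MassSpace →ₗ.[ℝ] MassSpace where
  domain := mulDomain r
  toFun :=
    { toFun := fun f => MassSpace.mk (fun i => r (i + 1) * (f : MassSpace) (i + 1))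
        (summable_shift (g := fun i => r i * (f : MassSpace) i) f.2)
      map_add' := fun f g => by ext i; simp; ring
      map_smul' := fun c f => by ext i; simp; ring }

/-- The operator `A₀ + A₁`, on `D(A₀) ∩ D(A₁)`; see `decayOp_domain`. -/
def decayOp (r a d : ℕ+ → ℝ) : MassSpace →ₗ.[ℝ] MassSpace := lossOp r a d + shiftOp r

/-- For nonnegative rates `D(A₀) ⊆ D(A₁)`, so that the domain of `A₀ + A₁` is `D(A₀)`. -/
theorem decayOp_domain {r a d : ℕ+ → ℝ} (hr : ∀ i, 0 ≤ r i) (ha : ∀ i, 0 ≤ a i)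
    (hd : ∀ i, 0 ≤ d i) : (decayOp r a d).domain = (lossOp r a d).domain := by
  refine inf_eq_left.2 fun f hf => ?_
  have h : Summable fun n : ℕ+ => (n : ℝ) * |lossRate r a d n * f n| := hf
  refine Summable.of_nonneg_of_le (fun n => by positivity) (fun n => ?_) h
  refine mul_le_mul_of_nonneg_left ?_ (by positivity)
  have h1 := hr n
  have h2 := ha n
  have h3 := hd n
  have h4 : r n ≤ lossRate r a d n := by unfold lossRate; linarith
  rw [abs_mul, abs_mul, abs_of_nonneg h1, abs_of_nonneg (h1.trans h4)]
  exact mul_le_mul_of_nonneg_right h4 (abs_nonneg _)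

/-- A strongly continuous (`C₀`-) semigroup of bounded operators on a normed space. -/
structure IsC0Semigroup {E : Type*} [NormedAddCommGroup E] [NormedSpace ℝ E]
    (S : ℝ≥0 → E →L[ℝ] E) : Prop where
  map_zero : S 0 = ContinuousLinearMap.id ℝ E
  map_add : ∀ s t, S (s + t) = (S s).comp (S t)
  tendsto_zero : ∀ f : E, Tendsto (fun t => S t f) (𝓝 0) (𝓝 f)

/-- `K` is the generator of `S`: `f ∈ D(K)` and `K f = g` if and only if
`(S(t) f - f) / t → g` as `t → 0+`. -/
def IsGeneratorOf {E : Type*} [NormedAddCommGroup E] [NormedSpace ℝ E]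
    (K : E →ₗ.[ℝ] E) (S : ℝ≥0 → E →L[ℝ] E) : Prop :=
  ∀ f g : E, (f, g) ∈ K.graph ↔
    Tendsto (fun t : ℝ≥0 => (t : ℝ)⁻¹ • (S t f - f)) (𝓝[>] 0) (𝓝 g)

/-- A substochastic `C₀`-semigroup on `X`: positive contractions. -/
structure IsSubstochasticSemigroup (S : ℝ≥0 → MassSpace →L[ℝ] MassSpace) : Prop
    extends IsC0Semigroup S where
  nonneg : ∀ t (f : MassSpace), f.IsNonneg → (S t f).IsNonneg
  norm_le_one : ∀ t, ‖S t‖ ≤ 1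

/-- The coefficients `c_n = a_n + d_n + r_n / n`. -/
def massLossRate (r a d : ℕ+ → ℝ) (n : ℕ+) : ℝ := a n + d n + r n / (n : ℝ)

end

/-! Decay moves mass only from size `n + 1` to size `n`, so the sequences supported on the first `N`
sizes form an invariant subspace, on which `A₀ + A₁` is a bounded operator `B N`. For large `c` the
operator `B N + c` is positive, and its norm is at most `c` because mass is only lost; hence `exp (t
• B N)` is a positive contraction. These exponentials agree on common truncations, and truncations
converge strongly to the identity, so they have a strong limit, the semigroup
(`IsContractiveExhaustion`).

The truncated pairs are dense in the graph of `A₀ + A₁`. Their closure lies in the generator by the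
mean value inequality (`tendsto_of_mem_closure`), which also gives closability, and exhausts it
because `1 - B N` is invertible and the generator is dissipative (`mem_closure_of_tendsto`).

For truncated sequences the mass balance is a rearrangement of sums. Comparing `f` with `|f|` gives
`∑ n c_n |f_n| ≤ ‖K f‖` there; this bound extends to the closure and makes both sides of the balance
continuous in the graph norm. -/

namespace NormedSpace

/-! ### Exponentials of bounded operators. -/

variable {E : Type*} [NormedAddCommGroup E] [NormedSpace ℝ E] [CompleteSpace E]

theorem hasSum_exp_apply (x : E →L[ℝ] E) (u : E) :
    HasSum (fun n : ℕ => ((n.factorial : ℝ)⁻¹) • (x ^ n) u) (exp x u) :=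
  (exp_series_hasSum_exp' (𝕂 := ℝ) x).mapL (ContinuousLinearMap.apply ℝ E u)

theorem norm_exp_apply_le (x : E →L[ℝ] E) (u : E) : ‖exp x u‖ ≤ Real.exp ‖x‖ * ‖u‖ := by
  have h1 : HasSum (fun n : ℕ => ((n.factorial : ℝ)⁻¹ * ‖x‖ ^ n) * ‖u‖)
      (Real.exp ‖x‖ * ‖u‖) := by
    rw [Real.exp_eq_exp_ℝ]
    exact (exp_series_hasSum_exp' (𝕂 := ℝ) ‖x‖).mul_right _
  rw [← (hasSum_exp_apply x u).tsum_eq]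
  refine tsum_of_norm_bounded h1 fun n => ?_
  rw [norm_smul, norm_inv, Real.norm_natCast, mul_assoc]
  refine mul_le_mul_of_nonneg_left ?_ (by positivity)
  induction n with
  | zero => simp
  | succ n ih =>
    rw [pow_succ', pow_succ', mul_assoc]
    exact (x.le_opNorm _).trans (mul_le_mul_of_nonneg_left ih (norm_nonneg x))

theorem exp_add_clm_of_commute {x y : E →L[ℝ] E} (h : Commute x y) :
    exp (x + y) = exp x * exp y :=
  letI : NormedAlgebra ℚ (E →L[ℝ] E) := NormedAlgebra.restrictScalars ℚ ℝ (E →L[ℝ] E)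
  exp_add_of_commute h

/-- A shift by `c` costs only a scalar factor, so contractivity and positivity can be read off from
`B + c`. -/
theorem exp_smul_eq_smul_exp (B : E →L[ℝ] E) (c t : ℝ) :
    exp (t • B) = Real.exp (-(t * c)) • exp (t • (B + c • 1)) := by
  have h : t • B = (-(t * c)) • (1 : E →L[ℝ] E) + t • (B + c • 1) := by
    rw [smul_add, smul_smul, neg_smul]; abel
  have hc : Commute ((-(t * c)) • (1 : E →L[ℝ] E)) (t • (B + c • 1)) :=
    (Commute.one_left _).smul_left _
  conv_lhs => rw [h]
  rw [exp_add_clm_of_commute hc, ← Algebra.algebraMap_eq_smul_one,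
    ← algebraMap_exp_comm, Algebra.algebraMap_eq_smul_one, smul_one_mul,
    Real.exp_eq_exp_ℝ]

theorem norm_exp_smul_apply_le {B : E →L[ℝ] E} {c : ℝ} (h : ‖B + c • 1‖ ≤ c) {t : ℝ}
    (ht : 0 ≤ t) (u : E) : ‖exp (t • B) u‖ ≤ ‖u‖ := by
  rw [exp_smul_eq_smul_exp B c t, smul_apply, norm_smul, Real.norm_eq_abs,
    Real.abs_exp]
  have h1 : ‖t • (B + c • 1)‖ ≤ t * c := by
    rw [norm_smul, Real.norm_of_nonneg ht]
    exact mul_le_mul_of_nonneg_left h ht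
  calc Real.exp (-(t * c)) * ‖exp (t • (B + c • 1)) u‖
      ≤ Real.exp (-(t * c)) * (Real.exp (t * c) * ‖u‖) := by
        refine mul_le_mul_of_nonneg_left ((norm_exp_apply_le _ _).trans ?_) (Real.exp_nonneg _)
        exact mul_le_mul_of_nonneg_right (Real.exp_le_exp.2 h1) (norm_nonneg u)
    _ = ‖u‖ := by rw [← mul_assoc, ← Real.exp_add]; simp

/-- A shifted contraction has `1` in its resolvent set. -/
theorem isUnit_one_sub_of_norm_add_le {B : E →L[ℝ] E} {c : ℝ} (h : ‖B + c • 1‖ ≤ c) :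
    IsUnit (1 - B) := by
  have hc : 0 ≤ c := (norm_nonneg _).trans h
  have hc1 : 0 < 1 + c := by linarith
  -- Neumann series: the norm is at most `c / (1 + c) < 1`.
  have h1 : ‖(1 + c)⁻¹ • (B + c • 1)‖ < 1 := by
    rw [norm_smul, norm_inv, Real.norm_of_nonneg hc1.le, inv_mul_lt_iff₀ hc1]
    linarith
  have h2 : 1 - B = (1 + c) • (1 - (1 + c)⁻¹ • (B + c • 1)) := by
    rw [smul_sub, smul_smul, mul_inv_cancel₀ hc1.ne', one_smul, add_smul, one_smul]; abel
  rw [h2]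
  exact (isUnit_one_sub_of_norm_lt_one h1).smul (Units.mk0 _ hc1.ne')

end NormedSpace

/-! ### Limit semigroup of an exhaustion and its generator. -/

/-- Bounded operators `B N`, together with truncations `P N`, such that `B N` is the restriction
of one fixed operator to the (increasing, invariant) ranges of the `P N`, and generates a
contraction semigroup. -/
structure IsContractiveExhaustion {E : Type*} [NormedAddCommGroup E] [NormedSpace ℝ E]
    (P B : ℕ → E →L[ℝ] E) : Prop where
  tendsto_trunc : ∀ f, Tendsto (fun N => P N f) atTop (𝓝 f)
  apply_trunc : ∀ M N f, M ≤ N → B N (P M f) = B M f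
  trunc_apply : ∀ N f, P N (B N f) = B N f
  trunc_trunc : ∀ N f, P N (P N f) = P N f
  norm_add_le : ∀ N, ∃ c : ℝ, ‖B N + c • 1‖ ≤ c

namespace IsContractiveExhaustion

open NormedSpace

variable {E : Type*} [NormedAddCommGroup E] [NormedSpace ℝ E] {P B : ℕ → E →L[ℝ] E}
  {A : E →ₗ.[ℝ] E}

/-- The truncated pairs are a core: each `(f, A f)` is the limit of `(P N f, B N f)`. -/
theorem closure_graph_eq (h : IsContractiveExhaustion P B)
    (hmem : ∀ N f, (P N f, B N f) ∈ A.graph)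
    (happrox : ∀ p ∈ A.graph, Tendsto (fun N => B N p.1) atTop (𝓝 p.2)) :
    (A.graph.topologicalClosure : Set (E × E)) =
      closure {p : E × E | ∃ N u, p = (P N u, B N u)} := by
  rw [Submodule.topologicalClosure_coe]
  refine subset_antisymm (closure_minimal (fun p hp => ?_) isClosed_closure) (closure_mono ?_)
  · exact _root_.mem_closure_of_tendsto ((h.tendsto_trunc p.1).prodMk_nhds (happrox p hp))
      (Eventually.of_forall fun N => ⟨N, p.1, rfl⟩)
  · rintro _ ⟨N, u, rfl⟩
    exact hmem N u

variable [CompleteSpace E]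

theorem norm_exp_apply_le (h : IsContractiveExhaustion P B) (N : ℕ) (t : ℝ≥0) (u : E) :
    ‖exp ((t : ℝ) • B N) u‖ ≤ ‖u‖ := by
  obtain ⟨c, hc⟩ := h.norm_add_le N
  exact norm_exp_smul_apply_le hc t.2 u

/-- The range of `P M` is invariant and `B N = B M` on it, so the two exponential series agree term
by term. -/
theorem exp_apply_trunc (h : IsContractiveExhaustion P B) {M N : ℕ} (hMN : M ≤ N) (t : ℝ)
    (f : E) : exp (t • B N) (P M f) = exp (t • B M) (P M f) := by
  refine (hasSum_exp_apply _ _).unique ?_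
  convert hasSum_exp_apply (t • B M) (P M f) using 3 with k
  rw [smul_pow, smul_pow, smul_apply, smul_apply]
  congr 1
  induction k generalizing f with
  | zero => rfl
  | succ k ih =>
    rw [pow_succ, pow_succ, mul_apply_eq_comp, mul_apply_eq_comp,
      h.apply_trunc M N f hMN, h.apply_trunc M M f le_rfl, ← h.trunc_apply M f, ih]

theorem exists_tendsto_exp (h : IsContractiveExhaustion P B) (t : ℝ≥0) (f : E) :
    ∃ g, Tendsto (fun N => exp ((t : ℝ) • B N) f) atTop (𝓝 g) := by
  refine cauchySeq_tendsto_of_complete (Metric.cauchySeq_iff'.2 fun ε hε => ?_)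
  obtain ⟨M, hM⟩ := ((Metric.tendsto_nhds.1 (h.tendsto_trunc f)) (ε / 2) (by positivity)).exists
  refine ⟨M, fun N hN => ?_⟩
  -- The contributions of `P M f` cancel; the tail `f - P M f` is small and both exponentials are
  -- contractions.
  have key : exp ((t : ℝ) • B N) f - exp ((t : ℝ) • B M) f =
      exp ((t : ℝ) • B N) (f - P M f) - exp ((t : ℝ) • B M) (f - P M f) := by
    rw [map_sub, map_sub, h.exp_apply_trunc hN]; abel
  rw [dist_eq_norm, key]
  rw [dist_eq_norm, norm_sub_rev] at hM
  have h1 := h.norm_exp_apply_le N t (f - P M f)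
  have h2 := h.norm_exp_apply_le M t (f - P M f)
  have h3 := norm_sub_le (exp ((t : ℝ) • B N) (f - P M f)) (exp ((t : ℝ) • B M) (f - P M f))
  linarith

/-- The strong limit of the semigroups generated by the `B N`. -/
noncomputable def semigroup (h : IsContractiveExhaustion P B) (t : ℝ≥0) : E →L[ℝ] E :=
  continuousLinearMapOfTendsto (l := atTop) (fun N => exp ((t : ℝ) • B N))
    (f := fun f => (h.exists_tendsto_exp t f).choose)
    (tendsto_pi_nhds.2 fun f => (h.exists_tendsto_exp t f).choose_spec)

theorem tendsto_semigroup (h : IsContractiveExhaustion P B) (t : ℝ≥0) (f : E) :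
    Tendsto (fun N => exp ((t : ℝ) • B N) f) atTop (𝓝 (h.semigroup t f)) :=
  (h.exists_tendsto_exp t f).choose_spec

theorem norm_semigroup_apply_le (h : IsContractiveExhaustion P B) (t : ℝ≥0) (f : E) :
    ‖h.semigroup t f‖ ≤ ‖f‖ :=
  le_of_tendsto (h.tendsto_semigroup t f).norm
    (Eventually.of_forall fun N => h.norm_exp_apply_le N t f)

theorem norm_semigroup_le_one (h : IsContractiveExhaustion P B) (t : ℝ≥0) :
    ‖h.semigroup t‖ ≤ 1 :=
  ContinuousLinearMap.opNorm_le_bound _ zero_le_one fun f => by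
    rw [one_mul]; exact h.norm_semigroup_apply_le t f

theorem semigroup_trunc (h : IsContractiveExhaustion P B) (N : ℕ) (t : ℝ≥0) (f : E) :
    h.semigroup t (P N f) = exp ((t : ℝ) • B N) (P N f) := by
  refine tendsto_nhds_unique (h.tendsto_semigroup t (P N f)) ?_
  refine tendsto_const_nhds.congr' ?_
  filter_upwards [eventually_ge_atTop N] with M hM
  exact (h.exp_apply_trunc hM t f).symm

theorem isC0Semigroup (h : IsContractiveExhaustion P B) : IsC0Semigroup h.semigroup where
  map_zero := by
    ext f
    refine tendsto_nhds_unique (h.tendsto_semigroup 0 f) ?_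
    simp
  map_add s t := by
    ext f
    rw [ContinuousLinearMap.comp_apply]
    refine tendsto_nhds_unique (h.tendsto_semigroup (s + t) f) ?_
    -- The bound `‖exp (s • B N)‖ ≤ 1`, uniform in `N`, lets the inner limit be taken first.
    have h1 : ∀ N, exp (((s + t : ℝ≥0) : ℝ) • B N) f =
        exp ((s : ℝ) • B N) (exp ((t : ℝ) • B N) f - h.semigroup t f) +
          exp ((s : ℝ) • B N) (h.semigroup t f) := fun N => by
      rw [map_sub, sub_add_cancel, NNReal.coe_add, add_smul, exp_add_clm_of_commute
        (((Commute.refl (B N)).smul_left _).smul_right _)]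
      rfl
    have h2 : Tendsto (fun N => exp ((s : ℝ) • B N) (exp ((t : ℝ) • B N) f - h.semigroup t f))
        atTop (𝓝 0) := by
      refine squeeze_zero_norm (fun N => h.norm_exp_apply_le N s _) ?_
      simpa using ((h.tendsto_semigroup t f).sub_const (h.semigroup t f)).norm
    simp only [h1]
    simpa only [zero_add] using h2.add (h.tendsto_semigroup s (h.semigroup t f))
  tendsto_zero f := by
    rw [Metric.tendsto_nhds]
    intro ε hε
    obtain ⟨M, hM⟩ :=
      ((Metric.tendsto_nhds.1 (h.tendsto_trunc f)) (ε / 3) (by positivity)).exists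
    have hcont : Continuous fun t : ℝ≥0 => exp ((t : ℝ) • B M) (P M f) := by
      have h1 : Continuous fun t : ℝ => exp (t • B M) := continuous_iff_continuousAt.2 fun t =>
        (hasDerivAt_exp_smul_const (B M) t).continuousAt
      exact (h1.comp NNReal.continuous_coe).clm_apply continuous_const
    have h0 : Tendsto (fun t : ℝ≥0 => exp ((t : ℝ) • B M) (P M f)) (𝓝 0) (𝓝 (P M f)) := by
      simpa using hcont.tendsto 0
    filter_upwards [Metric.tendsto_nhds.1 h0 (ε / 3) (by positivity)] with t ht
    rw [← h.semigroup_trunc] at ht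
    have h3 := h.norm_semigroup_apply_le t (f - P M f)
    rw [map_sub, ← dist_eq_norm, ← dist_eq_norm] at h3
    have h4 := dist_triangle4 (h.semigroup t f) (h.semigroup t (P M f)) (P M f) f
    rw [dist_comm f] at h3
    linarith

/-- Mean value inequality for `s ↦ S(s) P N f - s g`, with derivative `S(s)(B N f - g) + (S(s) g -
g)`. Here `g` need not be `B N f`: for fixed `g` the bound is a closed condition on the pair `(P N
f, B N f)`. -/
theorem norm_semigroup_sub_sub_le (h : IsContractiveExhaustion P B) {g : E} {t : ℝ≥0} {C : ℝ}
    (hC : ∀ s ≤ t, ‖h.semigroup s g - g‖ ≤ C) (N : ℕ) (f : E) :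
    ‖h.semigroup t (P N f) - P N f - (t : ℝ) • g‖ ≤ t * (‖B N f - g‖ + C) := by
  have hd : ∀ s ∈ Set.Icc (0 : ℝ) t, HasDerivWithinAt
      (fun s : ℝ => exp (s • B N) (P N f) - s • g)
      (exp (s • B N) (B N f) - g) (Set.Icc (0 : ℝ) t) s := fun s _ => by
    have h1 : HasDerivAt (fun s : ℝ => exp (s • B N) (P N f))
        ((exp (s • B N) * B N) (P N f)) s := by
      simpa using (hasDerivAt_exp_smul_const (B N) s).clm_apply (hasDerivAt_const s (P N f))
    rw [mul_apply_eq_comp, h.apply_trunc N N f le_rfl] at h1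
    have h2 : HasDerivAt (fun s : ℝ => s • g) g s := by
      simpa using (hasDerivAt_id s).smul_const g
    exact (h1.sub h2).hasDerivWithinAt
  have hb : ∀ s ∈ Set.Ico (0 : ℝ) t, ‖exp (s • B N) (B N f) - g‖ ≤ ‖B N f - g‖ + C := by
    intro s hs
    lift s to ℝ≥0 using hs.1
    have hst : s ≤ t := by exact_mod_cast hs.2.le
    have h1 : exp ((s : ℝ) • B N) (B N f) = h.semigroup s (B N f) := by
      rw [← h.trunc_apply N f, h.semigroup_trunc]
    have h2 : h.semigroup s (B N f) - g = h.semigroup s (B N f - g) + (h.semigroup s g - g) := by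
      rw [map_sub]; abel
    rw [h1, h2]
    exact (_root_.norm_add_le _ _).trans (add_le_add (h.norm_semigroup_apply_le s _) (hC s hst))
  have := norm_image_sub_le_of_norm_deriv_le_segment' hd hb t (Set.right_mem_Icc.2 t.2)
  simp only [zero_smul, exp_zero, sub_zero, one_apply_eq_self] at this
  rw [h.semigroup_trunc, sub_right_comm, mul_comm]
  exact this

/-- Limits of pairs `(P N f, B N f)` belong to the generator of the limit semigroup. -/
theorem tendsto_of_mem_closure (h : IsContractiveExhaustion P B) {f g : E}
    (hfg : (f, g) ∈ closure {p : E × E | ∃ N u, p = (P N u, B N u)}) :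
    Tendsto (fun t : ℝ≥0 => (t : ℝ)⁻¹ • (h.semigroup t f - f)) (𝓝[>] 0) (𝓝 g) := by
  -- At the limit pair `(f, g)` the term `‖B N f - g‖` becomes zero.
  have key : ∀ (t : ℝ≥0) (C : ℝ), (∀ s ≤ t, ‖h.semigroup s g - g‖ ≤ C) →
      ‖h.semigroup t f - f - (t : ℝ) • g‖ ≤ t * C := by
    intro t C hC
    have hcl : IsClosed {p : E × E |
        ‖h.semigroup t p.1 - p.1 - (t : ℝ) • g‖ ≤ t * (‖p.2 - g‖ + C)} :=
      isClosed_le (by fun_prop) (by fun_prop)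
    have := hcl.closure_subset_iff.2 (by
      rintro _ ⟨N, u, rfl⟩
      exact h.norm_semigroup_sub_sub_le hC N u) hfg
    simpa using this
  rw [Metric.tendsto_nhds]
  intro ε hε
  have h0 := Metric.tendsto_nhds.1 (h.isC0Semigroup.tendsto_zero g) (ε / 2) (by positivity)
  obtain ⟨δ, hδ, hball⟩ := Metric.eventually_nhds_iff.1 h0
  have h1 : ∀ᶠ t : ℝ≥0 in 𝓝[>] 0, dist t 0 < δ :=
    nhdsWithin_le_nhds (Metric.eventually_nhds_iff.2 ⟨δ, hδ, fun _ h => h⟩)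
  filter_upwards [h1, self_mem_nhdsWithin] with t ht htpos
  have htpos' : (0 : ℝ) < t := htpos
  have h2 := key t (ε / 2) fun s hs => by
    rw [← dist_eq_norm]
    refine (hball ?_).le
    refine lt_of_le_of_lt ?_ ht
    rw [NNReal.dist_eq, NNReal.dist_eq]
    simpa using hs
  have h3 : (t : ℝ)⁻¹ • (h.semigroup t f - f) - g =
      (t : ℝ)⁻¹ • (h.semigroup t f - f - (t : ℝ) • g) := by
    rw [smul_sub (_ : ℝ) (h.semigroup t f - f), smul_smul, inv_mul_cancel₀ htpos'.ne', one_smul]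
  rw [dist_eq_norm, h3, norm_smul, norm_inv, Real.norm_of_nonneg htpos'.le,
    inv_mul_lt_iff₀ htpos']
  nlinarith

/-- Generators of contraction semigroups are dissipative. -/
theorem norm_le_norm_sub (h : IsContractiveExhaustion P B) {f g : E}
    (hfg : Tendsto (fun t : ℝ≥0 => (t : ℝ)⁻¹ • (h.semigroup t f - f)) (𝓝[>] 0) (𝓝 g)) :
    ‖f‖ ≤ ‖f - g‖ := by
  refine ge_of_tendsto (tendsto_const_nhds.sub hfg).norm ?_
  filter_upwards [self_mem_nhdsWithin] with t (htpos : 0 < t)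
  have htpos' : (0 : ℝ) < t := htpos
  have h1 : f - (t : ℝ)⁻¹ • (h.semigroup t f - f) =
      (1 + (t : ℝ)⁻¹) • f - (t : ℝ)⁻¹ • h.semigroup t f := by
    rw [smul_sub, add_smul, one_smul]; abel
  have h2 := norm_sub_norm_le ((1 + (t : ℝ)⁻¹) • f) ((t : ℝ)⁻¹ • h.semigroup t f)
  have h3 : 0 < (t : ℝ)⁻¹ := inv_pos.2 htpos'
  rw [norm_smul, norm_smul, Real.norm_of_nonneg (by positivity), Real.norm_of_nonneg h3.le] at h2
  have h4 := mul_le_mul_of_nonneg_left (h.norm_semigroup_apply_le t f) h3.le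
  rw [h1]
  linarith

/-- Solve `u - B N u = P N (f - g)` in the range of `P N`. Dissipativity, applied to the difference
with `(f, g)`, bounds `‖u - f‖` by `‖P N (f - g) - (f - g)‖`, which tends to zero. -/
theorem mem_closure_of_tendsto (h : IsContractiveExhaustion P B) {f g : E}
    (hfg : Tendsto (fun t : ℝ≥0 => (t : ℝ)⁻¹ • (h.semigroup t f - f)) (𝓝[>] 0) (𝓝 g)) :
    (f, g) ∈ closure {p : E × E | ∃ N u, p = (P N u, B N u)} := by
  have hres : ∀ N, ∃ u, P N u = u ∧ u - B N u = P N (f - g) := fun N => by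
    obtain ⟨c, hc⟩ := h.norm_add_le N
    obtain ⟨v, hv⟩ := (isUnit_one_sub_of_norm_add_le hc).exists_right_inv
    have hu : v (P N (f - g)) - B N (v (P N (f - g))) = P N (f - g) :=
      congrArg (fun T : E →L[ℝ] E => T (P N (f - g))) hv
    refine ⟨v (P N (f - g)), ?_, hu⟩
    -- The solution is fixed by `P N`, since `u = P N (f - g) + B N u` and both terms are.
    rw [sub_eq_iff_eq_add] at hu
    conv_lhs => rw [hu, map_add, h.trunc_apply, h.trunc_trunc]
    exact hu.symm
  choose u hPu hu using hres
  have hmem : ∀ N, (u N, B N (u N)) ∈ closure {p : E × E | ∃ N u, p = (P N u, B N u)} :=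
    fun N => subset_closure ⟨N, u N, by rw [hPu]⟩
  have hlim : Tendsto u atTop (𝓝 f) := by
    rw [tendsto_iff_norm_sub_tendsto_zero]
    have h0 : Tendsto (fun N => ‖P N (f - g) - (f - g)‖) atTop (𝓝 0) :=
      tendsto_iff_norm_sub_tendsto_zero.1 (h.tendsto_trunc (f - g))
    refine squeeze_zero (fun _ => norm_nonneg _) (fun N => ?_) h0
    have h1 := h.norm_le_norm_sub (f := u N - f) (g := B N (u N) - g) (by
      refine ((h.tendsto_of_mem_closure (hmem N)).sub hfg).congr fun t => ?_
      rw [← smul_sub, map_sub]; congr 1; abel)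
    rwa [← hu, show u N - B N (u N) - (f - g) = u N - f - (B N (u N) - g) by abel]
  have hlim2 : Tendsto (fun N => B N (u N)) atTop (𝓝 g) := by
    have := hlim.sub (h.tendsto_trunc (f - g))
    rw [sub_sub_cancel] at this
    refine this.congr fun N => ?_
    rw [← hu, sub_sub_cancel]
  exact isClosed_closure.mem_of_tendsto (hlim.prodMk_nhds hlim2) (Eventually.of_forall hmem)

theorem isClosable (h : IsContractiveExhaustion P B)
    (hmem : ∀ N f, (P N f, B N f) ∈ A.graph)
    (happrox : ∀ p ∈ A.graph, Tendsto (fun N => B N p.1) atTop (𝓝 p.2)) : A.IsClosable := by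
  refine ⟨A.graph.topologicalClosure.toLinearPMap,
    (Submodule.toLinearPMap_graph_eq _ ?_).symm⟩
  -- A limit pair `(0, y)` forces `y` to be the derivative of `S(t) 0 = 0`.
  rintro ⟨x, y⟩ hxy (rfl : x = 0)
  rw [← SetLike.mem_coe, h.closure_graph_eq hmem happrox] at hxy
  refine tendsto_nhds_unique (h.tendsto_of_mem_closure hxy) ?_
  simp

theorem isGeneratorOf_closure (h : IsContractiveExhaustion P B)
    (hmem : ∀ N f, (P N f, B N f) ∈ A.graph)
    (happrox : ∀ p ∈ A.graph, Tendsto (fun N => B N p.1) atTop (𝓝 p.2)) :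
    IsGeneratorOf A.closure h.semigroup := by
  intro f g
  rw [← (h.isClosable hmem happrox).graph_closure_eq_closure_graph, ← SetLike.mem_coe,
    h.closure_graph_eq hmem happrox]
  exact ⟨h.tendsto_of_mem_closure, h.mem_closure_of_tendsto⟩

end IsContractiveExhaustion

/-! ### Completeness of the mass space, cutoffs and the shift. -/

namespace MassSpace

theorem norm_le_mul_norm {f g : MassSpace} {C : ℝ} (h : ∀ n, |f n| ≤ C * |g n|) :
    ‖f‖ ≤ C * ‖g‖ := by
  rw [norm_def, norm_def, ← tsum_mul_left]
  refine f.summable.tsum_le_tsum (fun n => ?_) (g.summable.mul_left C)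
  rw [mul_left_comm]
  exact mul_le_mul_of_nonneg_left (h n) (by positivity)

theorem mul_abs_apply_le_norm (f : MassSpace) (n : ℕ+) : (n : ℝ) * |f n| ≤ ‖f‖ :=
  f.summable.le_tsum n fun m _ => by positivity

theorem abs_apply_le_norm (f : MassSpace) (n : ℕ+) : |f n| ≤ ‖f‖ := by
  refine le_trans ?_ (f.mul_abs_apply_le_norm n)
  have : (1 : ℝ) ≤ n := by exact_mod_cast n.pos
  nlinarith [abs_nonneg (f n)]

@[simp] theorem sub_apply (f g : MassSpace) (n : ℕ+) : (f - g) n = f n - g n := rfl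

/-- The isometric identification `f ↦ (n f_n)` of `X` with `ℓ¹`. -/
noncomputable def toLp : MassSpace ≃ₗᵢ[ℝ] lp (fun _ : ℕ+ => ℝ) 1 where
  toFun f := ⟨fun n => (n : ℝ) * f n, memℓp_gen (by simpa [abs_mul] using f.summable)⟩
  invFun g := mk (fun n => (n : ℝ)⁻¹ * g n) (by
    have h : Summable fun n : ℕ+ => |g n| := by
      simpa using (memℓp_gen_iff (by simp)).1 (lp.memℓp g)
    refine h.congr fun n => ?_
    rw [abs_mul, abs_inv, Nat.abs_cast, mul_inv_cancel_left₀ (by simp)])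
  left_inv f := by ext n; simp
  right_inv g := by ext n; simp
  map_add' f g := by ext n; exact mul_add _ _ _
  map_smul' c f := by ext n; exact mul_left_comm _ _ _
  norm_map' f := by
    rw [lp.norm_eq_tsum_rpow (by simp), norm_def]
    simp

instance : CompleteSpace MassSpace :=
  (completeSpace_congr (e := toLp.toEquiv) toLp.isometry.isUniformEmbedding).2 inferInstance

/-- The coordinate functionals. -/
noncomputable def coord (n : ℕ+) : MassSpace →L[ℝ] ℝ :=
  LinearMap.mkContinuous ⟨⟨fun f => f n, fun _ _ => rfl⟩, fun _ _ => rfl⟩ 1 fun f => by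
    rw [one_mul]; exact f.abs_apply_le_norm n

@[simp] theorem coord_apply (n : ℕ+) (f : MassSpace) : coord n f = f n := rfl

@[fun_prop] theorem continuous_apply (n : ℕ+) : Continuous fun f : MassSpace => f n :=
  (coord n).continuous

theorem summable_mul (f : MassSpace) : Summable fun n : ℕ+ => (n : ℝ) * f n :=
  Summable.of_abs (by simpa [abs_mul] using f.summable)

theorem abs_tsum_le_norm (f : MassSpace) : |∑' n : ℕ+, (n : ℝ) * f n| ≤ ‖f‖ := by
  have h : Summable fun n : ℕ+ => ‖(n : ℝ) * f n‖ := by simpa [abs_mul] using f.summable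
  simpa [abs_mul, norm_def] using norm_tsum_le_tsum_norm h

/-- The sequence `w`, replaced by zero beyond index `N`. -/
def cutoff (N : ℕ) (w : ℕ+ → ℝ) (n : ℕ+) : ℝ := if (n : ℕ) ≤ N then w n else 0

theorem cutoff_of_le {N : ℕ} {n : ℕ+} (h : (n : ℕ) ≤ N) (w : ℕ+ → ℝ) : cutoff N w n = w n :=
  if_pos h

theorem cutoff_of_lt {N : ℕ} {n : ℕ+} (h : N < (n : ℕ)) (w : ℕ+ → ℝ) : cutoff N w n = 0 :=
  if_neg h.not_ge

/-- A crude bound independent of `n`; the same sum later serves as the shift `c`. -/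
theorem abs_cutoff_le (N : ℕ) (w : ℕ+ → ℝ) (n : ℕ+) :
    |cutoff N w n| ≤ ∑ i ∈ Finset.range N, |w i.succPNat| := by
  rcases le_or_gt (n : ℕ) N with h | h
  · rw [cutoff_of_le h]
    have := Finset.single_le_sum (f := fun i : ℕ => |w i.succPNat|) (fun i _ => abs_nonneg _)
      (Finset.mem_range.2 (lt_of_lt_of_le (Nat.pred_lt n.ne_zero) h))
    rwa [show (n : ℕ).pred.succPNat = n from n.succPNat_natPred] at this
  · rw [cutoff_of_lt h, abs_zero]
    exact Finset.sum_nonneg fun i _ => abs_nonneg _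

theorem summable_cutoff (N : ℕ) (w : ℕ+ → ℝ) (f : MassSpace) :
    Summable fun n : ℕ+ => (n : ℝ) * |cutoff N w n * f n| := by
  refine Summable.of_nonneg_of_le (fun n => by positivity) (fun n => ?_)
    (f.summable.mul_left (∑ i ∈ Finset.range N, |w i.succPNat|))
  rw [abs_mul, mul_left_comm]
  exact mul_le_mul_of_nonneg_right (abs_cutoff_le N w n) (by positivity)

/-- Multiplication by `w` on the first `N` coordinates. -/
noncomputable def cutMul (N : ℕ) (w : ℕ+ → ℝ) : MassSpace →L[ℝ] MassSpace :=
  LinearMap.mkContinuous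
    ⟨⟨fun f => mk (fun n => cutoff N w n * f n) (summable_cutoff N w f),
      fun f g => by ext n; simp [mul_add]⟩, fun c f => by ext n; simp [mul_left_comm]⟩
    (∑ i ∈ Finset.range N, |w i.succPNat|) fun f => norm_le_mul_norm fun n => by
      simpa [abs_mul] using mul_le_mul_of_nonneg_right (abs_cutoff_le N w n) (abs_nonneg (f n))

@[simp] theorem cutMul_apply (N : ℕ) (w : ℕ+ → ℝ) (f : MassSpace) (n : ℕ+) :
    cutMul N w f n = cutoff N w n * f n := rfl

theorem cutMul_cutMul_one {M N : ℕ} (h : M ≤ N) (w : ℕ+ → ℝ) (f : MassSpace) :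
    cutMul N w (cutMul M 1 f) = cutMul M w f := by
  ext n
  rcases le_or_gt (n : ℕ) M with hn | hn
  · simp [cutoff_of_le hn, cutoff_of_le (hn.trans h)]
  · simp [cutoff_of_lt hn]

theorem tendsto_cutMul_one (f : MassSpace) :
    Tendsto (fun N => cutMul N 1 f) atTop (𝓝 f) := by
  rw [tendsto_iff_norm_sub_tendsto_zero]
  have h := tendsto_tsum_of_dominated_convergence (𝓕 := atTop) (β := ℕ+)
    (f := fun (N : ℕ) (n : ℕ+) => (n : ℝ) * |(cutMul N 1 f - f) n|) (g := fun _ => 0)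
    f.summable (fun n => ?_) (Eventually.of_forall fun N n => ?_)
  · rw [tsum_zero] at h
    exact h
  · refine tendsto_const_nhds.congr' ?_
    filter_upwards [eventually_ge_atTop (n : ℕ)] with N hN
    simp [cutoff_of_le hN]
  · rw [Real.norm_of_nonneg (by positivity)]
    refine mul_le_mul_of_nonneg_left ?_ (by positivity)
    rcases le_or_gt (n : ℕ) N with hn | hn
    · simp [cutoff_of_le hn]
    · simp [cutoff_of_lt hn]

/-- The weight `n - 1` vanishes at `n = 1`, the only index missed by the shift. -/
theorem hasSum_shift {g : ℕ+ → ℝ} {s : ℝ} (h : HasSum (fun n : ℕ+ => ((n : ℝ) - 1) * g n) s) :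
    HasSum (fun n : ℕ+ => (n : ℝ) * g (n + 1)) s := by
  have hinj : Function.Injective fun n : ℕ+ => n + 1 := fun m n h => add_right_cancel h
  have h1 := (hinj.hasSum_iff (f := fun n : ℕ+ => ((n : ℝ) - 1) * g n) (a := s) fun n hn => ?_).2 h
  · simpa [Function.comp_def] using h1
  · rcases eq_or_ne n 1 with rfl | hn1
    · simp
    · exact absurd ⟨_, PNat.sub_add_of_lt (lt_of_le_of_ne one_le hn1.symm)⟩ hn

/-- The left shift `f ↦ (f_{n+1})`. -/
noncomputable def shift : MassSpace →L[ℝ] MassSpace :=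
  LinearMap.mkContinuous
    ⟨⟨fun f => mk (fun n => f (n + 1)) (summable_shift f.summable),
      fun f g => by ext n; simp⟩, fun c f => by ext n; simp⟩ 1 fun f => by
    have hinj : Function.Injective fun n : ℕ+ => n + 1 := fun m n h => add_right_cancel h
    rw [one_mul]
    refine Summable.tsum_le_tsum_of_inj (fun n : ℕ+ => n + 1) hinj (fun n _ => by positivity)
      (fun n => mul_le_mul_of_nonneg_right ?_ (abs_nonneg _)) (summable_shift f.summable) f.summable
    push_cast
    linarith

@[simp] theorem shift_apply (f : MassSpace) (n : ℕ+) : shift f n = f (n + 1) := rfl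

/-- The operator with loss rates `θ` and decay rates `r` restricted to the first `N` sizes. -/
noncomputable def cutDecay (r θ : ℕ+ → ℝ) (N : ℕ) : MassSpace →L[ℝ] MassSpace :=
  shift.comp (cutMul N r) - cutMul N θ

theorem cutDecay_apply (r θ : ℕ+ → ℝ) (N : ℕ) (f : MassSpace) (n : ℕ+) :
    cutDecay r θ N f n = cutoff N r (n + 1) * f (n + 1) - cutoff N θ n * f n := rfl

end MassSpace

/-! ### Mass loss, contractivity and positivity of the cut-off operators. -/

namespace MassSpace

variable {r θ : ℕ+ → ℝ}

theorem cutoff_nonneg {w : ℕ+ → ℝ} (hw : ∀ n, 0 ≤ w n) (N : ℕ) (n : ℕ+) :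
    0 ≤ cutoff N w n := by
  unfold cutoff; split_ifs; exacts [hw n, le_rfl]

theorem cutoff_le_cutoff {w v : ℕ+ → ℝ} (h : ∀ n, w n ≤ v n) (N : ℕ) (n : ℕ+) :
    cutoff N w n ≤ cutoff N v n := by
  unfold cutoff; split_ifs; exacts [h n, le_rfl]

/-- The coordinatewise absolute value. -/
noncomputable def abs (f : MassSpace) : MassSpace :=
  mk (fun n => |f n|) (by simpa using f.summable)

@[simp] theorem abs_apply (f : MassSpace) (n : ℕ+) : f.abs n = |f n| := rfl

theorem summable_sub_one_mul_cutoff (N : ℕ) (w : ℕ+ → ℝ) (f : MassSpace) :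
    Summable fun n : ℕ+ => ((n : ℝ) - 1) * (cutoff N w n * f n) := by
  refine Summable.of_norm_bounded (summable_cutoff N w f) fun n => ?_
  rw [Real.norm_eq_abs, abs_mul]
  have h1 : (1 : ℝ) ≤ n := by exact_mod_cast n.pos
  rw [abs_of_nonneg (by linarith : (0 : ℝ) ≤ n - 1)]
  exact mul_le_mul_of_nonneg_right (by linarith) (abs_nonneg _)

/-- The sum of all gain terms of the cut-off operator, rearranged as a sum over parent sizes. -/
theorem hasSum_gain (N : ℕ) (w : ℕ+ → ℝ) (f : MassSpace) :
    HasSum (fun n : ℕ+ => (n : ℝ) * (cutoff N w (n + 1) * f (n + 1)))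
      (∑' n : ℕ+, ((n : ℝ) - 1) * (cutoff N w n * f n)) :=
  hasSum_shift (g := fun n => cutoff N w n * f n) (summable_sub_one_mul_cutoff N w f).hasSum

/-- The total mass of `f` lost per unit of time under the cut-off operator. -/
theorem tsum_cutDecay (r θ : ℕ+ → ℝ) (N : ℕ) (f : MassSpace) :
    ∑' n : ℕ+, (n : ℝ) * cutDecay r θ N f n =
      -∑' n : ℕ+, (n * cutoff N θ n - ((n : ℝ) - 1) * cutoff N r n) * f n := by
  have h1 := hasSum_gain N r f
  have h2 := (summable_sub_one_mul_cutoff N r f).hasSum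
  have h3 := (cutMul N θ f).summable_mul.hasSum
  have h4 : ∑' n : ℕ+, (n : ℝ) * cutDecay r θ N f n = _ :=
    (tsum_congr fun n => by rw [cutDecay_apply, cutMul_apply]; ring).trans (h1.sub h3).tsum_eq
  have h5 : ∑' n : ℕ+, (n * cutoff N θ n - ((n : ℝ) - 1) * cutoff N r n) * f n = _ :=
    (tsum_congr fun n => by rw [cutMul_apply]; ring).trans (h3.sub h2).tsum_eq
  rw [h4, h5]
  ring

/-- Coordinatewise, `|θ_n f_n - r_{n+1} f_{n+1}| ≥ θ_n |f_n| - r_{n+1} |f_{n+1}|`; summing the right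
side with weight `n` gives the mass loss of `|f|`. -/
theorem tsum_loss_le_norm_cutDecay (hr : ∀ n, 0 ≤ r n) (hθ : ∀ n, 0 ≤ θ n)
    (N : ℕ) (f : MassSpace) :
    ∑' n : ℕ+, (n * cutoff N θ n - ((n : ℝ) - 1) * cutoff N r n) * |f n| ≤
      ‖cutDecay r θ N f‖ := by
  have h := tsum_cutDecay r θ N f.abs
  simp only [abs_apply] at h
  rw [eq_neg_iff_add_eq_zero, add_comm, ← eq_neg_iff_add_eq_zero] at h
  rw [h, norm_def, ← tsum_neg]
  refine (cutDecay r θ N f.abs).summable_mul.neg.tsum_le_tsum (fun n => ?_)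
    (cutDecay r θ N f).summable
  rw [cutDecay_apply, cutDecay_apply, abs_apply, abs_apply, ← mul_neg]
  refine mul_le_mul_of_nonneg_left ?_ (by positivity)
  have h1 := abs_sub_abs_le_abs_sub (cutoff N θ n * f n) (cutoff N r (n + 1) * f (n + 1))
  rw [abs_sub_comm, abs_mul, abs_mul, abs_of_nonneg (cutoff_nonneg hr N _),
    abs_of_nonneg (cutoff_nonneg hθ N _)] at h1
  linarith

/-- Since `c` dominates every cut-off loss rate, `B + c` is positive and `|(B + c) f| ≤ (B + c)
|f|`. The mass of the right side is `c ‖f‖` minus a loss, nonnegative because `r ≤ θ`. -/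
theorem norm_cutDecay_add_le (hr : ∀ n, 0 ≤ r n) (hrθ : ∀ n, r n ≤ θ n) (N : ℕ) :
    ‖cutDecay r θ N + (∑ i ∈ Finset.range N, |θ i.succPNat|) • 1‖ ≤
      ∑ i ∈ Finset.range N, |θ i.succPNat| := by
  set c := ∑ i ∈ Finset.range N, |θ i.succPNat| with hc
  have hθc : ∀ n, cutoff N θ n ≤ c := fun n => (le_abs_self _).trans (abs_cutoff_le N θ n)
  refine ContinuousLinearMap.opNorm_le_bound _
    (Finset.sum_nonneg fun i _ => abs_nonneg _) fun f => ?_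
  have h1 : ‖(cutDecay r θ N + c • 1) f‖ ≤
      ∑' n : ℕ+, (n : ℝ) * (cutDecay r θ N + c • 1) f.abs n := by
    rw [norm_def]
    refine Summable.tsum_le_tsum (fun n => ?_) (summable _) (summable_mul _)
    refine mul_le_mul_of_nonneg_left ?_ (by positivity)
    change |cutDecay r θ N f n + c * f n| ≤ cutDecay r θ N f.abs n + c * f.abs n
    rw [cutDecay_apply, cutDecay_apply, abs_apply, abs_apply]
    have h2 := abs_add_le (cutoff N r (n + 1) * f (n + 1)) ((c - cutoff N θ n) * f n)
    rw [abs_mul, abs_mul, abs_of_nonneg (cutoff_nonneg hr N _),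
      abs_of_nonneg (sub_nonneg.2 (hθc n))] at h2
    calc _ = _ := by congr 1; ring
      _ ≤ _ := h2
      _ = _ := by ring
  have h2 : ∑' n : ℕ+, (n : ℝ) * (cutDecay r θ N + c • 1) f.abs n =
      -∑' n : ℕ+, (n * cutoff N θ n - ((n : ℝ) - 1) * cutoff N r n) * |f n| + c * ‖f‖ := by
    rw [norm_def, ← tsum_mul_left]
    have h := tsum_cutDecay r θ N f.abs
    simp only [abs_apply] at h
    rw [← h, ← (summable_mul _).tsum_add (f.summable.mul_left c)]
    refine tsum_congr fun n => ?_
    change (n : ℝ) * (cutDecay r θ N f.abs n + c * |f n|) = _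
    ring
  have h3 : 0 ≤ ∑' n : ℕ+, (n * cutoff N θ n - ((n : ℝ) - 1) * cutoff N r n) * |f n| := by
    refine tsum_nonneg fun n => mul_nonneg ?_ (abs_nonneg _)
    have h4 := cutoff_le_cutoff hrθ N n
    have h5 := cutoff_nonneg hr N n
    have h6 : (1 : ℝ) ≤ n := by exact_mod_cast n.pos
    nlinarith
  linarith

theorem isContractiveExhaustion_cutDecay (hr : ∀ n, 0 ≤ r n) (hrθ : ∀ n, r n ≤ θ n) :
    IsContractiveExhaustion (fun N => cutMul N 1) (cutDecay r θ) where
  tendsto_trunc := tendsto_cutMul_one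
  apply_trunc M N f h := by simp [cutDecay, cutMul_cutMul_one h]
  trunc_apply N f := by
    ext n
    rcases le_or_gt (n : ℕ) N with hn | hn
    · simp [cutoff_of_le hn]
    · have hn' : N < ((n + 1 : ℕ+) : ℕ) := by rw [PNat.add_coe]; omega
      simp [cutDecay_apply, cutoff_of_lt hn, cutoff_of_lt hn']
  trunc_trunc N f := cutMul_cutMul_one le_rfl 1 f
  norm_add_le N := ⟨_, norm_cutDecay_add_le hr hrθ N⟩

theorem isNonneg_exp_apply {T : MassSpace →L[ℝ] MassSpace}
    (hT : ∀ f : MassSpace, f.IsNonneg → (T f).IsNonneg) {f : MassSpace} (hf : f.IsNonneg) :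
    (NormedSpace.exp T f).IsNonneg := by
  intro n
  refine ((NormedSpace.hasSum_exp_apply T f).mapL (coord n)).nonneg fun k => ?_
  have hk : ((T ^ k) f).IsNonneg := by
    induction k with
    | zero => exact hf
    | succ k ih => rw [pow_succ']; exact hT _ ih
  exact mul_nonneg (by positivity) (hk n)

theorem isNonneg_exp_cutDecay (hr : ∀ n, 0 ≤ r n) (N : ℕ) (t : ℝ≥0) {f : MassSpace}
    (hf : f.IsNonneg) : (NormedSpace.exp ((t : ℝ) • cutDecay r θ N) f).IsNonneg := by
  set c := ∑ i ∈ Finset.range N, |θ i.succPNat| with hc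
  have hθc : ∀ n, cutoff N θ n ≤ c := fun n => (le_abs_self _).trans (abs_cutoff_le N θ n)
  rw [NormedSpace.exp_smul_eq_smul_exp _ c]
  intro n
  refine mul_nonneg (Real.exp_nonneg _) (isNonneg_exp_apply (fun g hg n => ?_) hf n)
  refine mul_nonneg t.2 ?_
  change 0 ≤ cutDecay r θ N g n + c * g n
  rw [cutDecay_apply]
  nlinarith [mul_nonneg (cutoff_nonneg hr N (n + 1)) (hg (n + 1)),
    mul_nonneg (sub_nonneg.2 (hθc n)) (hg n)]

theorem isNonneg_of_tendsto {u : ℕ → MassSpace} {f : MassSpace} (h : Tendsto u atTop (𝓝 f))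
    (hu : ∀ N, (u N).IsNonneg) : f.IsNonneg := fun n =>
  ge_of_tendsto (((continuous_apply n).tendsto f).comp h) (Eventually.of_forall fun N => hu N n)

end MassSpace

/-! ### The decay operator, its closure and the mass balance. -/

namespace MassSpace

variable {r a d : ℕ+ → ℝ}

theorem cutMul_eq_cutMul_one (N : ℕ) {w : ℕ+ → ℝ} {f g : MassSpace} (h : ∀ n, g n = w n * f n) :
    cutMul N w f = cutMul N 1 g := by
  ext n
  rw [cutMul_apply, cutMul_apply, h]
  rcases le_or_gt (n : ℕ) N with hn | hn
  · simp [cutoff_of_le hn]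
  · simp [cutoff_of_lt hn]

theorem mul_cutoff_one (N : ℕ) (w : ℕ+ → ℝ) (n : ℕ+) : w n * cutoff N 1 n = cutoff N w n := by
  rcases le_or_gt (n : ℕ) N with hn | hn
  · simp [cutoff_of_le hn]
  · simp [cutoff_of_lt hn]

theorem cutMul_one_mem_mulDomain (N : ℕ) (w : ℕ+ → ℝ) (f : MassSpace) :
    cutMul N 1 f ∈ mulDomain w := by
  refine (summable_cutoff N w f).congr fun n => ?_
  rw [cutMul_apply, ← mul_assoc, mul_cutoff_one]

theorem cutMul_mem_graph_decayOp (N : ℕ) (f : MassSpace) :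
    (cutMul N 1 f, cutDecay r (lossRate r a d) N f) ∈ (decayOp r a d).graph := by
  rw [LinearPMap.mem_graph_iff]
  refine ⟨⟨cutMul N 1 f, cutMul_one_mem_mulDomain N _ f, cutMul_one_mem_mulDomain N _ f⟩, rfl, ?_⟩
  ext n
  change -(lossRate r a d n) * (cutoff N 1 n * f n) +
    r (n + 1) * (cutoff N 1 (n + 1) * f (n + 1)) = _
  rw [cutDecay_apply, ← mul_cutoff_one N r, ← mul_cutoff_one N (lossRate r a d)]
  ring

theorem tendsto_cutDecay {p : MassSpace × MassSpace} (hp : p ∈ (decayOp r a d).graph) :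
    Tendsto (fun N => cutDecay r (lossRate r a d) N p.1) atTop (𝓝 p.2) := by
  obtain ⟨x, hx, hy⟩ := (LinearPMap.mem_graph_iff _).1 hp
  obtain ⟨hx1, hx2⟩ := x.2
  let g : MassSpace := mk (fun n => r n * (x : MassSpace) n) hx2
  let k : MassSpace := mk (fun n => lossRate r a d n * (x : MassSpace) n) hx1
  have h1 : p.2 = shift g - k := by
    rw [← hy]
    ext n
    change -(lossRate r a d n) * (x : MassSpace) n + r (n + 1) * (x : MassSpace) (n + 1) =
      r (n + 1) * (x : MassSpace) (n + 1) - lossRate r a d n * (x : MassSpace) n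
    ring
  rw [h1, ← hx]
  refine (((shift.continuous.tendsto g).comp (tendsto_cutMul_one g)).sub
    (tendsto_cutMul_one k)).congr fun N => ?_
  change _ = shift (cutMul N r x) - cutMul N (lossRate r a d) x
  rw [cutMul_eq_cutMul_one N (g := g) fun n => rfl, cutMul_eq_cutMul_one N (g := k) fun n => rfl]
  rfl

/-- The origin of `c_n`: `n θ_n - (n - 1) r_n = n (a_n + d_n) + r_n`. -/
theorem mul_cutoff_lossRate_sub (N : ℕ) (n : ℕ+) :
    n * cutoff N (lossRate r a d) n - ((n : ℝ) - 1) * cutoff N r n =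
      n * massLossRate r a d n * cutoff N 1 n := by
  have h : (n : ℝ) ≠ 0 := by simp
  rw [← mul_cutoff_one, ← mul_cutoff_one N r, massLossRate, lossRate]
  field_simp
  ring

theorem le_lossRate (ha : ∀ n, 0 ≤ a n) (hd : ∀ n, 0 ≤ d n) (n : ℕ+) :
    r n ≤ lossRate r a d n := by
  have h1 := ha n
  have h2 := hd n
  unfold lossRate; linarith

theorem massLossRate_nonneg (hr : ∀ n, 0 ≤ r n) (ha : ∀ n, 0 ≤ a n) (hd : ∀ n, 0 ≤ d n)
    (n : ℕ+) : 0 ≤ massLossRate r a d n :=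
  add_nonneg (add_nonneg (ha n) (hd n)) (div_nonneg (hr n) (by positivity))

theorem tsum_cutDecay_lossRate (N : ℕ) (f : MassSpace) :
    ∑' n : ℕ+, (n : ℝ) * cutDecay r (lossRate r a d) N f n =
      -∑' n : ℕ+, (n : ℝ) * massLossRate r a d n * cutMul N 1 f n := by
  rw [tsum_cutDecay]
  congr 1
  refine tsum_congr fun n => ?_
  rw [mul_cutoff_lossRate_sub, cutMul_apply, mul_assoc]

theorem summable_massLoss_cutMul (hr : ∀ n, 0 ≤ r n) (ha : ∀ n, 0 ≤ a n) (hd : ∀ n, 0 ≤ d n)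
    (N : ℕ) (f : MassSpace) :
    Summable fun n : ℕ+ => (n : ℝ) * massLossRate r a d n * |cutMul N 1 f n| := by
  refine (summable_cutoff N (massLossRate r a d) f).congr fun n => ?_
  rw [cutMul_apply, ← mul_cutoff_one, mul_assoc, mul_assoc, abs_mul,
    abs_of_nonneg (massLossRate_nonneg hr ha hd n)]

theorem tsum_massLoss_cutMul_le (hr : ∀ n, 0 ≤ r n) (ha : ∀ n, 0 ≤ a n) (hd : ∀ n, 0 ≤ d n)
    (N : ℕ) (f : MassSpace) :
    ∑' n : ℕ+, (n : ℝ) * massLossRate r a d n * |cutMul N 1 f n| ≤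
      ‖cutDecay r (lossRate r a d) N f‖ := by
  refine le_trans (le_of_eq (tsum_congr fun n => ?_)) (tsum_loss_le_norm_cutDecay hr
    (fun n => (hr n).trans (le_lossRate ha hd n)) N f)
  rw [mul_cutoff_lossRate_sub, cutMul_apply, abs_mul,
    abs_of_nonneg (cutoff_nonneg (w := 1) (fun _ => zero_le_one) N n), mul_assoc _ (cutoff N 1 n)]

/-- On the closure of the decay operator the mass loss is controlled by the norm of the image. -/
theorem sum_massLoss_le_norm (hr : ∀ n, 0 ≤ r n) (ha : ∀ n, 0 ≤ a n) (hd : ∀ n, 0 ≤ d n)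
    {p : MassSpace × MassSpace} (hp : p ∈ closure {p : MassSpace × MassSpace |
      ∃ N f, p = (cutMul N 1 f, cutDecay r (lossRate r a d) N f)}) (s : Finset ℕ+) :
    ∑ n ∈ s, (n : ℝ) * massLossRate r a d n * |p.1 n| ≤ ‖p.2‖ := by
  -- Finite partial sums are continuous in the pair, so the bound passes to the closure before
  -- convergence of the series is known.
  have hcl : IsClosed {p : MassSpace × MassSpace |
      ∑ n ∈ s, (n : ℝ) * massLossRate r a d n * |p.1 n| ≤ ‖p.2‖} := by
    refine isClosed_le (continuous_finsetSum _ fun n _ => ?_) (by fun_prop)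
    exact continuous_const.mul ((continuous_apply n).comp continuous_fst).abs
  refine hcl.closure_subset_iff.2 ?_ hp
  rintro _ ⟨N, f, rfl⟩
  refine le_trans ((summable_massLoss_cutMul hr ha hd N f).sum_le_tsum s fun n _ => ?_)
    (tsum_massLoss_cutMul_le hr ha hd N f)
  exact mul_nonneg (mul_nonneg (by positivity) (massLossRate_nonneg hr ha hd n)) (abs_nonneg _)

theorem mem_closure_graph_decayOp_iff (hr : ∀ n, 0 ≤ r n) (ha : ∀ n, 0 ≤ a n) (hd : ∀ n, 0 ≤ d n)
    {p : MassSpace × MassSpace} : p ∈ (decayOp r a d).graph.topologicalClosure ↔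
      p ∈ closure {p : MassSpace × MassSpace |
      ∃ N f, p = (cutMul N 1 f, cutDecay r (lossRate r a d) N f)} := by
  rw [← SetLike.mem_coe, (isContractiveExhaustion_cutDecay hr (le_lossRate ha hd)).closure_graph_eq
    cutMul_mem_graph_decayOp fun p hp => tendsto_cutDecay hp]

theorem norm_massLoss (hr : ∀ n, 0 ≤ r n) (ha : ∀ n, 0 ≤ a n) (hd : ∀ n, 0 ≤ d n)
    (f : MassSpace) (n : ℕ+) :
    ‖(n : ℝ) * massLossRate r a d n * f n‖ = n * massLossRate r a d n * |f n| := by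
  rw [Real.norm_eq_abs, abs_mul, abs_of_nonneg
    (mul_nonneg (by positivity) (massLossRate_nonneg hr ha hd n))]

theorem summable_massLoss (hr : ∀ n, 0 ≤ r n) (ha : ∀ n, 0 ≤ a n) (hd : ∀ n, 0 ≤ d n)
    {p : MassSpace × MassSpace} (hp : p ∈ (decayOp r a d).graph.topologicalClosure) :
    Summable fun n : ℕ+ => (n : ℝ) * massLossRate r a d n * |p.1 n| :=
  summable_of_sum_le (fun n => mul_nonneg (mul_nonneg (by positivity)
    (massLossRate_nonneg hr ha hd n)) (abs_nonneg _))
    (sum_massLoss_le_norm hr ha hd ((mem_closure_graph_decayOp_iff hr ha hd).1 hp))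

theorem summable_massLoss' (hr : ∀ n, 0 ≤ r n) (ha : ∀ n, 0 ≤ a n) (hd : ∀ n, 0 ≤ d n)
    {p : MassSpace × MassSpace} (hp : p ∈ (decayOp r a d).graph.topologicalClosure) :
    Summable fun n : ℕ+ => (n : ℝ) * massLossRate r a d n * p.1 n :=
  Summable.of_norm (by simpa only [norm_massLoss hr ha hd] using summable_massLoss hr ha hd hp)

theorem abs_tsum_massLoss_le (hr : ∀ n, 0 ≤ r n) (ha : ∀ n, 0 ≤ a n) (hd : ∀ n, 0 ≤ d n)
    {p : MassSpace × MassSpace} (hp : p ∈ (decayOp r a d).graph.topologicalClosure) :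
    |∑' n : ℕ+, (n : ℝ) * massLossRate r a d n * p.1 n| ≤ ‖p.2‖ := by
  have hs := summable_massLoss hr ha hd hp
  rw [← Real.norm_eq_abs]
  refine (norm_tsum_le_tsum_norm (by simpa only [norm_massLoss hr ha hd] using hs)).trans ?_
  simp only [norm_massLoss hr ha hd]
  exact hs.tsum_le_of_sum_le
    (sum_massLoss_le_norm hr ha hd ((mem_closure_graph_decayOp_iff hr ha hd).1 hp))

/-- The mass balance for the closure of the decay operator. -/
theorem tsum_eq_neg_massLoss (hr : ∀ n, 0 ≤ r n) (ha : ∀ n, 0 ≤ a n) (hd : ∀ n, 0 ≤ d n)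
    {f g : MassSpace} (hf : (f, g) ∈ (decayOp r a d).graph.topologicalClosure) :
    ∑' n : ℕ+, (n : ℝ) * g n = -∑' n : ℕ+, (n : ℝ) * massLossRate r a d n * f n := by
  rw [eq_neg_iff_add_eq_zero, ← abs_nonpos_iff]
  refine le_of_forall_pos_le_add fun ε hε => ?_
  obtain ⟨_, ⟨N, u, rfl⟩, hu⟩ := Metric.mem_closure_iff.1
    ((mem_closure_graph_decayOp_iff hr ha hd).1 hf) (ε / 2) (by positivity)
  have hmem : (cutMul N 1 u, cutDecay r (lossRate r a d) N u) ∈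
      (decayOp r a d).graph.topologicalClosure :=
    subset_closure (cutMul_mem_graph_decayOp N u)
  -- Both functionals are bounded by the norm of the second component of the difference pair, below
  -- `ε / 2`, and the balance is exact for the truncated pair.
  have h1 := abs_tsum_massLoss_le hr ha hd (sub_mem hf hmem)
  have h2 := abs_tsum_le_norm (g - cutDecay r (lossRate r a d) N u)
  have h3 : ‖g - cutDecay r (lossRate r a d) N u‖ < ε / 2 := by
    rw [← dist_eq_norm]
    exact lt_of_le_of_lt (le_max_right _ _) hu
  simp only [Prod.mk_sub_mk, sub_apply, mul_sub] at h1 h2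
  rw [(summable_massLoss' hr ha hd hf).tsum_sub (summable_massLoss' hr ha hd hmem)] at h1
  rw [g.summable_mul.tsum_sub (summable_mul _), tsum_cutDecay_lossRate] at h2
  rw [abs_le] at h1 h2 ⊢
  constructor <;> linarith

end MassSpace

open MassSpace

theorem theorem2p1 (r a d : ℕ+ → ℝ) (hr : ∀ i, 0 < r i) (hd : ∀ i, 0 ≤ d i)
    (ha1 : a 1 = 0) (ha : ∀ i, 2 ≤ i → 0 < a i) :
    (decayOp r a d).domain = (lossOp r a d).domain ∧
    (decayOp r a d).IsClosable ∧
    (∃ S : ℝ≥0 → MassSpace →L[ℝ] MassSpace,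
      IsSubstochasticSemigroup S ∧ IsGeneratorOf (decayOp r a d).closure S) ∧
    ∀ f : (decayOp r a d).closure.domain,
      (Summable fun n : ℕ+ => (n : ℝ) * massLossRate r a d n * |(f : MassSpace) n|) ∧
      ∑' n : ℕ+, (n : ℝ) * ((decayOp r a d).closure f) n =
        -∑' n : ℕ+, (n : ℝ) * massLossRate r a d n * (f : MassSpace) n := by
  have hr0 : ∀ n, 0 ≤ r n := fun n => (hr n).le
  have ha0 : ∀ n, 0 ≤ a n := fun n => by
    rcases eq_or_ne n 1 with rfl | hn
    · exact ha1.ge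
    · exact (ha n (PNat.add_one_le_iff.2 (lt_of_le_of_ne one_le hn.symm))).le
  have h := isContractiveExhaustion_cutDecay hr0 (le_lossRate (r := r) ha0 hd)
  have happrox : ∀ p ∈ (decayOp r a d).graph,
      Tendsto (fun N => cutDecay r (lossRate r a d) N p.1) atTop (𝓝 p.2) :=
    fun p hp => tendsto_cutDecay hp
  have hclos := h.isClosable cutMul_mem_graph_decayOp happrox
  have hS : IsSubstochasticSemigroup h.semigroup :=
    { h.isC0Semigroup with
      nonneg := fun t f hf => isNonneg_of_tendsto (h.tendsto_semigroup t f) fun N =>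
        isNonneg_exp_cutDecay hr0 N t hf
      norm_le_one := h.norm_semigroup_le_one }
  refine ⟨decayOp_domain hr0 ha0 hd, hclos,
    ⟨h.semigroup, hS, h.isGeneratorOf_closure cutMul_mem_graph_decayOp happrox⟩, fun f => ?_⟩
  have hf : ((f : MassSpace), (decayOp r a d).closure f) ∈
      (decayOp r a d).graph.topologicalClosure := by
    rw [hclos.graph_closure_eq_closure_graph]
    exact LinearPMap.mem_graph _ f
  have h1 := summable_massLoss hr0 ha0 hd hf
  have h2 := tsum_eq_neg_massLoss hr0 ha0 hd hf
  generalize (decayOp r a d).closure f = g at *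
  exact ⟨h1, h2⟩
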